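/- **Setting.** Let $n\ge 2$, $\mathcal A=\{1,\dots,n\}$, and let $\sigma$ be an irreducible Pisot substitution over $\mathcal A$: for the incidence matrix $M_\sigma=(|\sigma(j)|_i)_{i,j}$ the characteristic polynomial is irreducible over $\mathbb Q$, and $M_\sigma$ has an eigenvalue $\alpha>1$ all of whose other conjugates have modulus $<1$. Assume that $\sigma$ has a fixed point $u=(u_i)_{i\in\mathbb Z}\in\mathcal A^{\mathbb Z}$, $\sigma(u)=u$. *Subshift.* A state $(b:p)$ consists of a letter $b$ and a proper (possibly empty) prefix $p$ of $\sigma(b)$; write $\sigma(b)=pas$ with $a\in\mathcal A$. $\Sigma_A$ is the set of sequences of states $\omega=(b_{k+1}:p_k)_{k\ge0}$, $\sigma(b_{k+1})=p_ka_ks_k$, with $a_{k+1}=b_{k+1}$ for all $k\geq 0$, and $T$ is the shift on $\Sigma_A$. Let $\mathrm{Pref}$ be the set of all prefixes $p$ of states, and let $f(p)\in\mathbb Z^n$ be the vector that counts the letters of $p$. *Number field.* Let $K=\mathbb Q(\alpha)\subset\mathbb R$ with ring of integers $\mathfrak O_K$. Let $\mathfrak M$ consist of the infinite places of $K$ other than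 the place $v_1$ of the inclusion $K\subset\mathbb R$, and of the finite places of the prime ideals $\mathfrak p_1,\dots,\mathfrak p_\kappa$ dividing $(\alpha)=\mathfrak p_1^{\nu_1}\cdots\mathfrak p_\kappa^{\nu_\kappa}$; put $q_i=\mathfrak N(\mathfrak p_i)$. Let $K_v$ be the completion of $K$ at $v$, with the usual absolute value $|\cdot|$ of $\mathbb R$ or $\mathbb C$ if $v$ is infinite and with the normalized absolute value $|\cdot|_v$ (so $|\alpha|_v=q_i^{-\nu_i}$ at $\mathfrak p_i$) if $v$ is finite. Let $K_\sigma=\prod_{v\in\mathfrak M}K_v$, let $\Phi':K\to K_\sigma$ be the diagonal embedding, and let $x_v$ be the image of $x\in K$ in $K_v$. *Representation.* Let $\mathbf v\in\mathfrak O_K^n$ satisfy ${}^tM_\sigma\mathbf v=\alpha\mathbf v$ and have positive coordinates. For $\omega=(b_{k+1}:p_k)_{k\ge 0}$ put $\Psi(\omega)=\bigl(\sum_{k\ge0}\langle f(p_k),\mathbf v\rangle_v\,\alpha_v^k\bigr)_{v\in\mathfrak M}\in K_\sigma$. Let $\gamma=\Phi'(\langle\mathbf w,\mathbf v\rangle)$,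 where $\mathbf w\in\bigcup_{i\ge0}M_\sigma^{-i}\mathbb Z^n$ satisfies $\langle\mathbf w,\mathbf v\rangle\in\mathfrak O_K$ and, for some $b\in\mathcal A$ with standard basis vector $\mathbf e_b$, $\langle\mathbf w,\mathbf v\rangle\ge0$ and $\langle\mathbf w-\mathbf e_b,\mathbf v\rangle<0$. *Polynomial part.* For $\omega_1=(a_{k+1}:p_k)_{k\ge 0}$, $\omega_2=(b_{k+1}:q_k)_{k\ge 0}$ in $\Sigma_A$ and an integer $d\ge0$, the polynomial part of $\Psi(\omega_1)-\Psi(\omega_2)-\gamma$ at $d$ is $$F(\alpha)=\sum_{k=0}^{d-1}\alpha^k\langle f(p_k),\mathbf v\rangle-\sum_{k=0}^{d-1}\alpha^k\langle f(q_k),\mathbf v\rangle-\langle\mathbf w,\mathbf v\rangle .$$ Writing each $\langle f(p_k),\mathbf v\rangle$, $\langle f(q_k),\mathbf v\rangle$ and $\langle\mathbf w,\mathbf v\rangle$ in the basis $1,\alpha,\dots,\alpha^{n-1}$ of $K$ over $\mathbb Q$ makes $F$ a polynomial in $\alpha$. Let $M>0$ be an upper bound for the moduli of the coefficients of these polynomials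 for all $\omega_1,\omega_2\in\Sigma_A$ and all $d\ge0$. *Special cylinder.* Put $M_v=\max\{|\langle f(p),\mathbf v\rangle_v|:p\in\mathrm{Pref}\}$. Let $L$ be an integer with $L\ge N+1$ for some $N>0$ such that $M_\sigma^N$ is positive, and with $$2|\alpha_v|^{L-n+3}\frac{M_v}{1-|\alpha_v|}\Bigl(\frac{M}{1-\alpha^{-1}}\Bigr)^{\frac1{n-1}}+|\alpha_v|<1\quad\text{for the infinite } v\in\mathfrak M,$$ $$2q_i^{-\nu_i(L-n+3)}+q_i^{-\nu_i}<1\quad(1\le i\le\kappa).$$ Let $\mathcal C\subset\Sigma_A$ be the cylinder of all $\omega$ with $\omega_0=\dots=\omega_L=(u_0:\emptyset)$. *Neighbourhoods.* For $d\ge1$ and $X\in K_\sigma$ let $O_d(X)$ be the set of all $Y\in K_\sigma$ with $|X_v-Y_v|<|\alpha_v|^{d+n-2}\bigl(\frac{1-\alpha^{-1}}M\bigr)^{\frac1{n-1}}$ for the infinite $v\in\mathfrak M$ and $|X_v-Y_v|_v<q_i^{-(d+n-2)\nu_i}$ for $v$ corresponding to $\mathfrak p_i$, $1\le i\le\kappa$.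 **Theorem.** Let $d\ge0$ and $\omega_1,\omega_2\in\Sigma_A$. If $(T\times T)^d(\omega_1,\omega_2)\in\mathcal C\times\mathcal C$, then either the polynomial part of $\Psi(\omega_1)-\Psi(\omega_2)-\gamma$ at $d$ vanishes, or $\Psi(\omega_2)+\gamma\notin O_{d+1}(\Psi(\omega_1))$. -/

import Mathlib

open scoped IntermediateField

noncomputable section

namespace PisotSubst

/-! ### Substitutions -/

/-- The incidence matrix: the entry `(i, j)` is the number of letters `i` in the word `σ(j)`. -/
def incidence {n : ℕ} (σ : Fin n → List (Fin n)) : Matrix (Fin n) (Fin n) ℤ :=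
  Matrix.of fun i j => ((σ j).count i : ℤ)

/-- An irreducible Pisot substitution over the alphabet `Fin n`, together with its
Perron-Frobenius root `α`: the characteristic polynomial of the incidence matrix is irreducible
over `ℚ`, `α > 1` is an eigenvalue, and all other (complex) eigenvalues have modulus `< 1`. -/
structure IrreduciblePisotSubstitution (n : ℕ) where
  /-- the images of the letters -/
  σ : Fin n → List (Fin n)
  two_le : 2 ≤ n
  irreducible : Irreducible ((incidence σ).charpoly.map (Int.castRingHom ℚ))
  /-- the Perron-Frobenius root -/
  α : ℝ
  root : Polynomial.aeval α (incidence σ).charpoly = 0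
  one_lt : 1 < α
  conj_lt : ∀ z : ℂ, Polynomial.aeval z (incidence σ).charpoly = 0 → z ≠ (α : ℂ) → ‖z‖ < 1

/-- The word `u_a u_{a+1} ⋯ u_{a+l-1}` of a bi-infinite sequence. -/
def block {n : ℕ} (u : ℤ → Fin n) (a : ℤ) (l : ℕ) : List (Fin n) :=
  (List.range l).map fun i => u (a + i)

variable {n : ℕ} (S : IrreduciblePisotSubstitution n)

/-- `σ(u) = u`, where
`σ(u) = ⋯ σ(u_{-2}) σ(u_{-1}) . σ(u_0) σ(u_1) ⋯`: the word `σ(u_0 ⋯ u_{k-1})` is the block of `u`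
that starts at position `0`, and `σ(u_{-k} ⋯ u_{-1})` is the block that ends at position `-1`. -/
def IsFixedPoint (u : ℤ → Fin n) : Prop :=
  ∀ k : ℕ,
    (block u 0 k).flatMap S.σ = block u 0 ((block u 0 k).flatMap S.σ).length ∧
    (block u (-k) k).flatMap S.σ =
      block u (-(((block u (-k) k).flatMap S.σ).length : ℤ)) ((block u (-k) k).flatMap S.σ).length

/-! ### The subshift of finite type -/

/-- The states `(b : p a s)`, i.e. the prefix-suffix representations `σ(b) = p a s`.
Such a representation is given by the letter `b` and the position of `a` in `σ(b)`. -/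
abbrev State : Type := (b : Fin n) × Fin (S.σ b).length

variable {S} in
/-- The prefix `p` of the state `(b : p a s)`. -/
def State.pre (e : State S) : List (Fin n) := (S.σ e.1).take e.2

variable {S} in
/-- The letter `a` of the state `(b : p a s)`. -/
def State.letter (e : State S) : Fin n := (S.σ e.1).get e.2

/-- The subshift `Σ_A`: sequences `(b_{k+1} : p_k a_k s_k)_{k ≥ 0}` with `a_{k+1} = b_{k+1}`. -/
def Subshift : Type := {ω : ℕ → State S // ∀ k, (ω (k + 1)).letter = (ω k).1}

variable {S} in
/-- The shift `T` on `Σ_A`. -/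
def shift (ω : Subshift S) : Subshift S := ⟨fun k => ω.1 (k + 1), fun k => ω.2 (k + 1)⟩

/-- The cylinder of all `ω` with `ω_i = (c : ∅)` for `0 ≤ i ≤ L`. -/
def specialCylinder (c : Fin n) (L : ℕ) : Set (Subshift S) :=
  {ω | ∀ i ≤ L, (ω.1 i).1 = c ∧ (ω.1 i).pre = []}

/-! ### The number field `K = ℚ(α)` and its places -/

/-- `K = ℚ(α)`, as a subfield of `ℝ`. -/
abbrev FieldK : Type := ℚ⟮S.α⟯

lemma isIntegral_int_α : IsIntegral ℤ S.α :=
  ⟨_, Matrix.charpoly_monic _, S.root⟩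

lemma isIntegral_α : IsIntegral ℚ S.α := (isIntegral_int_α S).tower_top

instance : NumberField (FieldK S) where
  to_charZero := inferInstance
  to_finiteDimensional := IntermediateField.adjoin.finiteDimensional (isIntegral_α S)

/-- `α` as an element of `K`. -/
def alphaK : FieldK S := IntermediateField.AdjoinSimple.gen ℚ S.α

lemma isIntegral_alphaK : IsIntegral ℤ (alphaK S) := by
  have h : IsIntegral ℤ (algebraMap (FieldK S) ℝ (alphaK S)) := by
    simpa [alphaK] using isIntegral_int_α S
  exact (isIntegral_algebraMap_iff (algebraMap (FieldK S) ℝ).injective).1 h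

/-- `α` as an element of the ring of integers of `K`. -/
def alphaO : NumberField.RingOfIntegers (FieldK S) := ⟨alphaK S, isIntegral_alphaK S⟩

/-- The infinite place `v₁` with `|α|_{v₁} = α`, given by the inclusion `K ⊆ ℝ`. -/
def expandingPlace : NumberField.InfinitePlace (FieldK S) :=
  NumberField.InfinitePlace.mk ((algebraMap ℝ ℂ).comp (algebraMap (FieldK S) ℝ))

/-- The infinite places of `K` other than `v₁`. -/
abbrev InfPlace : Type := {v : NumberField.InfinitePlace (FieldK S) // v ≠ expandingPlace S}

/-- The finite places of `K` given by the prime ideals that divide `(α)`. -/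
abbrev FinPlace : Type :=
  {P : IsDedekindDomain.HeightOneSpectrum (NumberField.RingOfIntegers (FieldK S)) //
    P.asIdeal ∣ Ideal.span {alphaO S}}

variable {S} in
/-- The completion `K_v` at an infinite place (isometric to `ℝ` or `ℂ`); its norm is the usual
absolute value `|·|`. -/
abbrev InfPlace.Kv (v : InfPlace S) : Type := v.1.Completion

variable {S} in
/-- The completion `K_v` at a finite place; its norm is the normalized absolute value `|·|_v`. -/
abbrev FinPlace.Kv (v : FinPlace S) : Type := v.1.adicCompletion (FieldK S)

variable {S} in
/-- The absolute norm `q` of the prime ideal. -/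
def FinPlace.q (v : FinPlace S) : ℕ := Ideal.absNorm v.1.asIdeal

variable {S} in
/-- The exponent `ν` of the prime ideal in the factorization of `(α)`. -/
def FinPlace.ν (v : FinPlace S) : ℕ := multiplicity v.1.asIdeal (Ideal.span {alphaO S})

/-- The representation space `K_σ`. -/
abbrev KSigma : Type := ((v : InfPlace S) → v.Kv) × ((v : FinPlace S) → v.Kv)

/-- The diagonal embedding `Φ' : K → K_σ`. -/
def diag (x : FieldK S) : KSigma S :=
  (fun v => algebraMap (FieldK S) v.Kv x, fun v => algebraMap (FieldK S) v.Kv x)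

/-! ### Eigenvectors, the representation map and the translation vectors -/

/-- `v` is a left Perron-Frobenius eigenvector with positive coordinates in the
ring of integers of `K`. -/
structure IsIntegralEigenvector (v : Fin n → FieldK S) : Prop where
  eigen : ((incidence S.σ).map (Int.cast : ℤ → FieldK S)).transpose.mulVec v = alphaK S • v
  pos : ∀ i, 0 < (v i : ℝ)
  integral : ∀ i, IsIntegral ℤ (v i)

variable {S}

/-- `⟨w, v⟩` for a rational vector `w`. -/
def pairing (v : Fin n → FieldK S) (w : Fin n → ℚ) : FieldK S :=
  ∑ i, algebraMap ℚ (FieldK S) (w i) * v i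

/-- The abelianization `f` of words. -/
def abel (p : List (Fin n)) : Fin n → ℚ := fun i => (p.count i : ℚ)

/-- `⟨f(p), v⟩` for the prefix `p` of a state. -/
def digit (v : Fin n → FieldK S) (e : State S) : FieldK S := pairing v (abel e.pre)

/-- The map `Ψ : Σ_A → K_σ`, given by convergent power series in every `K_v`. -/
def Psi (v : Fin n → FieldK S) (ω : Subshift S) : KSigma S :=
  (fun x => ∑' i : ℕ, algebraMap (FieldK S) x.Kv (digit v (ω.1 i)) *
      algebraMap (FieldK S) x.Kv (alphaK S) ^ i,
   fun x => ∑' i : ℕ, algebraMap (FieldK S) x.Kv (digit v (ω.1 i)) *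
      algebraMap (FieldK S) x.Kv (alphaK S) ^ i)

/-- The pairs `(w, b)` with `w ∈ ⋃ᵢ M_σ⁻ⁱ ℤⁿ`, `⟨w, v⟩ ≥ 0` and `⟨w - e_b, v⟩ < 0`; they
parametrize the translation set `Γ` through `(w, b) ↦ (Φ'(⟨w, v⟩), b)`. -/
def translationVectors (v : Fin n → FieldK S) : Set ((Fin n → ℚ) × Fin n) :=
  {wb | (∃ i : ℕ, ∃ z : Fin n → ℤ,
          (((incidence S.σ).map (Int.cast : ℤ → ℚ)) ^ i).mulVec wb.1 = fun j => (z j : ℚ)) ∧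
        0 ≤ (pairing v wb.1 : ℝ) ∧
        (pairing v (wb.1 - Pi.single wb.2 1) : ℝ) < 0}

/-! ### Polynomial parts -/

/-- The value at `α` of the polynomial part of `Ψ(ω₁) - Ψ(ω₂) - Φ'(⟨w, v⟩)` at `d`. -/
def polyPart (v : Fin n → FieldK S) (w : Fin n → ℚ) (ω₁ ω₂ : Subshift S) (d : ℕ) : FieldK S :=
  ∑ k ∈ Finset.range d, alphaK S ^ k * digit v (ω₁.1 k) -
    ∑ k ∈ Finset.range d, alphaK S ^ k * digit v (ω₂.1 k) - pairing v w

/-- The unique polynomial `g ∈ ℚ[X]` of degree `< n` with `g(α) = x`: its coefficients are the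
coordinates of `x` in the basis `1, α, …, α^(n-1)` of `K`. -/
def coordPoly (x : FieldK S) : Polynomial ℚ :=
  ∑ j : Fin (IntermediateField.adjoin.powerBasis (isIntegral_α S)).dim, Polynomial.monomial (j : ℕ)
    ((IntermediateField.adjoin.powerBasis (isIntegral_α S)).basis.repr x j)

/-- The polynomial part of `Ψ(ω₁) - Ψ(ω₂) - Φ'(⟨w, v⟩)` at `d` as a polynomial in `α`, every
`⟨f(p), v⟩` and `⟨w, v⟩` being expanded in powers of `α`. -/
def polyPartPoly (v : Fin n → FieldK S) (w : Fin n → ℚ) (ω₁ ω₂ : Subshift S) (d : ℕ) :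
    Polynomial ℚ :=
  ∑ k ∈ Finset.range d, Polynomial.X ^ k * coordPoly (digit v (ω₁.1 k)) -
    ∑ k ∈ Finset.range d, Polynomial.X ^ k * coordPoly (digit v (ω₂.1 k)) -
    coordPoly (pairing v w)

/-- `M > 0` bounds all coefficients of all polynomial parts, independently of `ω₁, ω₂, d`. -/
def IsCoeffBound (v : Fin n → FieldK S) (w : Fin n → ℚ) (M : ℝ) : Prop :=
  0 < M ∧ ∀ (ω₁ ω₂ : Subshift S) (d j : ℕ), |(((polyPartPoly v w ω₁ ω₂ d).coeff j : ℚ) : ℝ)| ≤ M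

/-! ### The length of the special cylinder, and `d`-neighbourhoods -/

/-- `|α_v|` at an infinite place. -/
def absAlpha (x : InfPlace S) : ℝ := ‖algebraMap (FieldK S) x.Kv (alphaK S)‖

/-- `M_v = max {|⟨f(p), v(α_v)⟩| : p ∈ Pref}`, a maximum over the finitely many states. -/
def digitMax (v : Fin n → FieldK S) (x : InfPlace S) : ℝ :=
  ⨆ e : State S, ‖algebraMap (FieldK S) x.Kv (digit v e)‖

/-- The conditions on the parameter `L` of the special cylinder, given the bound `M`. -/
structure IsCylinderLength (v : Fin n → FieldK S) (M : ℝ) (L : ℕ) : Prop where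
  primitive : ∃ N : ℕ, 0 < N ∧ (∀ i j, 0 < ((incidence S.σ) ^ N) i j) ∧ N + 1 ≤ L
  infinite : ∀ x : InfPlace S,
    2 * absAlpha x ^ ((L : ℤ) - n + 3) * (digitMax v x / (1 - absAlpha x)) *
      (M / (1 - S.α⁻¹)) ^ (1 / ((n : ℝ) - 1)) + absAlpha x < 1
  finite : ∀ x : FinPlace S,
    2 * (1 / (x.q : ℝ)) ^ ((x.ν : ℤ) * ((L : ℤ) - n + 3)) + (1 / (x.q : ℝ)) ^ x.ν < 1

/-- The `d`-neighbourhood `O_d(X)` of `X ∈ K_σ` (for `d ≥ 1`; recall that `n ≥ 2`). -/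
def nbhd (M : ℝ) (d : ℕ) (X : KSigma S) : Set (KSigma S) :=
  {Y | (∀ x : InfPlace S,
          ‖X.1 x - Y.1 x‖ <
            absAlpha x ^ (d + n - 2) * ((1 - S.α⁻¹) / M) ^ (1 / ((n : ℝ) - 1))) ∧
       (∀ x : FinPlace S, ‖X.2 x - Y.2 x‖ < ((x.q : ℝ) ^ ((d + n - 2) * x.ν))⁻¹)}

end PisotSubst

end

open PisotSubst

namespace PisotSubst

/-! ### Power series with a gap in their coefficients -/

section PowerSeries

variable {E : Type*} [NormedField E] [CompleteSpace E]

/-! Write `F` for the polynomial part at `d` and `C = M / (1 - α⁻¹)`, and suppose that `Ψ(ω₂) + γ`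
does lie in `O_{d+1}(Ψ(ω₁))`. The claim is that the algebraic integer `F` is so small at every place
that it must vanish.

Visiting the cylinder at time `d` makes the digits with indices `d, …, d + L` zero, so at each
contracting place `F` differs from the corresponding component of `Ψ(ω₁) - Ψ(ω₂) - γ` only by tails
starting at `α^(d+L+1)`. The choice of `L` then gives `|F|_v < |α_v|^(d+n-2) * C^(-1/(n-1))` at the
infinite places other than `v₁` (`infinitePlace_polyPart_lt`), and `|F|_v ≤ |α|_v^(d+n-2)` at the
primes dividing `α` (`norm_finPlace_polyPart_le`). By the latter, `G = F / α^(d+n-2)` is still an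
algebraic integer (`isIntegral_div_alphaK_pow`).

At `v₁` the coefficient bound and a geometric sum give `|G| < C` (`abs_polyPart_lt`). The remaining
places contribute at most `C⁻¹` to the norm, as their multiplicities sum to `n - 1`. Hence `|N(G)| <
1` and `G = 0` (`eq_zero_of_infinitePlace_le`).

For `d = 0` the degree bound `d + n - 2` fails; there `⟨w, v⟩ < v_b` is combined with the bound
`eigenvector_le` on `v_b`. -/

lemma summable_mul_pow {a : E} (ha : ‖a‖ < 1) {c : ℕ → E} {D : ℝ} (hc : ∀ k, ‖c k‖ ≤ D) :
    Summable fun k => c k * a ^ k := by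
  refine Summable.of_norm_bounded
    ((summable_geometric_of_lt_one (norm_nonneg a) ha).mul_left D) fun k => ?_
  rw [norm_mul, norm_pow]
  exact mul_le_mul_of_nonneg_right (hc k) (by positivity)

lemma tsum_sub_sum_eq {a : E} (ha : ‖a‖ < 1) {c : ℕ → E} {D : ℝ} (hc : ∀ k, ‖c k‖ ≤ D)
    {d m : ℕ} (hz : ∀ i < m, c (d + i) = 0) :
    ∑' k, c k * a ^ k - ∑ k ∈ Finset.range d, c k * a ^ k =
      ∑' k, c (k + (d + m)) * a ^ (k + (d + m)) := by
  rw [← (summable_mul_pow ha hc).sum_add_tsum_nat_add (d + m), Finset.sum_range_add,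
    Finset.sum_eq_zero (s := Finset.range m) fun i hi => by
      rw [hz i (Finset.mem_range.1 hi), zero_mul]]
  ring

/-- A power series with bounded coefficients and a gap of length `m` after the first `d` terms is
close to its partial sum. -/
lemma norm_tsum_sub_sum_le {a : E} (ha : ‖a‖ < 1) {c : ℕ → E} {D : ℝ} (hc : ∀ k, ‖c k‖ ≤ D)
    {d m : ℕ} (hz : ∀ i < m, c (d + i) = 0) :
    ‖∑' k, c k * a ^ k - ∑ k ∈ Finset.range d, c k * a ^ k‖ ≤
      ‖a‖ ^ (d + m) * (D / (1 - ‖a‖)) := by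
  rw [tsum_sub_sum_eq ha hc hz]
  have hg := (hasSum_geometric_of_lt_one (norm_nonneg a) ha).mul_left (‖a‖ ^ (d + m) * D)
  refine (tsum_of_norm_bounded hg fun k => ?_).trans_eq (by rw [div_eq_mul_inv]; ring)
  rw [norm_mul, norm_pow, pow_add]
  calc ‖c (k + (d + m))‖ * (‖a‖ ^ k * ‖a‖ ^ (d + m)) ≤ D * (‖a‖ ^ k * ‖a‖ ^ (d + m)) :=
        mul_le_mul_of_nonneg_right (hc _) (by positivity)
    _ = _ := by ring

/-- The ultrametric version of `norm_tsum_sub_sum_le`. -/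
lemma norm_tsum_sub_sum_le_of_ultrametric [IsUltrametricDist E] {a : E} (ha : ‖a‖ < 1) {c : ℕ → E}
    (hc : ∀ k, ‖c k‖ ≤ 1) {d m : ℕ} (hz : ∀ i < m, c (d + i) = 0) :
    ‖∑' k, c k * a ^ k - ∑ k ∈ Finset.range d, c k * a ^ k‖ ≤ ‖a‖ ^ (d + m) := by
  rw [tsum_sub_sum_eq ha hc hz]
  refine IsUltrametricDist.norm_tsum_le_of_forall_le fun k => ?_
  rw [norm_mul, norm_pow]
  exact (mul_le_of_le_one_left (by positivity) (hc _)).trans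
    (pow_le_pow_of_le_one (norm_nonneg a) ha.le (by lia))

end PowerSeries

/-! ### Degree of `K` and size of `α` at the infinite places -/

section Field

variable {n : ℕ} (S : IrreduciblePisotSubstitution n)

lemma minpoly_alpha : minpoly ℚ S.α = (incidence S.σ).charpoly.map (Int.castRingHom ℚ) := by
  refine (minpoly.eq_of_irreducible_of_monic S.irreducible ?_
    ((Matrix.charpoly_monic _).map _)).symm
  have := S.root
  rwa [← Polynomial.aeval_map_algebraMap ℚ] at this

lemma natDegree_minpoly_alpha : (minpoly ℚ S.α).natDegree = n := by
  rw [minpoly_alpha, (Matrix.charpoly_monic _).natDegree_map, Matrix.charpoly_natDegree_eq_dim,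
    Fintype.card_fin]

lemma finrank_fieldK : Module.finrank ℚ (FieldK S) = n := by
  rw [IntermediateField.adjoin.finrank (isIntegral_α S), natDegree_minpoly_alpha]

lemma powerBasis_dim : (IntermediateField.adjoin.powerBasis (isIntegral_α S)).dim = n := by
  rw [IntermediateField.adjoin.powerBasis_dim, natDegree_minpoly_alpha]

lemma coe_alphaK : (alphaK S : ℝ) = S.α := IntermediateField.AdjoinSimple.coe_gen ℚ S.α

lemma alphaK_ne_zero : alphaK S ≠ 0 := by
  intro h
  have := S.one_lt
  rw [← coe_alphaK, h, ZeroMemClass.coe_zero] at this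
  linarith

lemma aeval_alphaK : Polynomial.aeval (alphaK S) (incidence S.σ).charpoly = 0 := by
  apply (algebraMap (FieldK S) ℝ).injective
  rw [map_zero, ← Polynomial.aeval_algebraMap_apply]
  exact (congrArg (fun t : ℝ => Polynomial.aeval t (incidence S.σ).charpoly) (coe_alphaK S)).trans
    S.root

lemma expandingPlace_apply (y : FieldK S) : expandingPlace S y = |(y : ℝ)| := by
  rw [expandingPlace, NumberField.InfinitePlace.apply]
  simp

lemma mult_expandingPlace : (expandingPlace S).mult = 1 := by
  apply NumberField.InfinitePlace.IsReal.mult_eq_one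
  rw [expandingPlace, NumberField.InfinitePlace.isReal_mk_iff,
    NumberField.ComplexEmbedding.isReal_iff]
  ext y
  simp

lemma norm_algebraMap_infPlace (x : InfPlace S) (y : FieldK S) :
    ‖algebraMap (FieldK S) x.Kv y‖ = x.1 y :=
  NumberField.InfinitePlace.Completion.norm_coe x.1 _

lemma absAlpha_eq (x : InfPlace S) : absAlpha x = x.1 (alphaK S) :=
  norm_algebraMap_infPlace S x _

lemma absAlpha_pos (x : InfPlace S) : 0 < absAlpha x := by
  rw [absAlpha_eq, NumberField.InfinitePlace.pos_iff]
  exact alphaK_ne_zero S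

/-- The image of `α` under an embedding is again an eigenvalue. It cannot be `α` itself: as `α`
generates `K`, the embedding would be the inclusion and the place would be `v₁`. -/
lemma absAlpha_lt_one (x : InfPlace S) : absAlpha x < 1 := by
  rw [absAlpha_eq, ← NumberField.InfinitePlace.norm_embedding_eq]
  apply S.conj_lt
  · have := congrArg x.1.embedding (aeval_alphaK S)
    rwa [map_zero, ← RingHom.toIntAlgHom_apply, ← Polynomial.aeval_algHom_apply] at this
  · intro h
    apply x.2
    rw [← NumberField.InfinitePlace.mk_embedding x.1]
    unfold expandingPlace
    congr 1
    have key : x.1.embedding.toRatAlgHom =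
        ((algebraMap ℝ ℂ).comp (algebraMap (FieldK S) ℝ)).toRatAlgHom := by
      apply (IntermediateField.adjoin.powerBasis (isIntegral_α S)).algHom_ext
      rw [IntermediateField.adjoin.powerBasis_gen]
      exact h
    ext y
    exact congrArg (fun f => f y) key

end Field

/-! ### Primes dividing `α`, integrality, and the norm argument -/

section Finite

variable {n : ℕ} {S : IrreduciblePisotSubstitution n}

open NumberField

lemma norm_algebraMap_finPlace (x : FinPlace S) (y : FieldK S) :
    ‖algebraMap (FieldK S) x.Kv y‖ = HeightOneSpectrum.adicAbv (FieldK S) x.1 y :=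
  FinitePlace.norm_embedding x.1 y

lemma norm_finPlace_le_one (x : FinPlace S) {y : FieldK S} (hy : IsIntegral ℤ y) :
    ‖algebraMap (FieldK S) x.Kv y‖ ≤ 1 :=
  FinitePlace.norm_le_one (FieldK S) x.1 (⟨y, hy⟩ : 𝓞 (FieldK S))

lemma FinPlace.one_lt_q (x : FinPlace S) : 1 < x.q := HeightOneSpectrum.one_lt_absNorm x.1

lemma norm_alphaK_finPlace (x : FinPlace S) :
    ‖algebraMap (FieldK S) x.Kv (alphaK S)‖ = ((x.q : ℝ) ^ x.ν)⁻¹ := by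
  have h0 : alphaO S ≠ 0 := fun h => alphaK_ne_zero S (congrArg Subtype.val h)
  have h := FinitePlace.norm_embedding_int (FieldK S) x.1 (alphaO S)
  rw [x.1.intValuation_eq_exp_neg_multiplicity h0,
    WithZeroMulInt.toNNReal_neg_apply _ WithZero.exp_ne_zero] at h
  refine h.trans ?_
  rw [← zpow_natCast, ← zpow_neg]
  rfl

lemma isIntegral_of_adicAbv_le_one {K : Type*} [Field K] [NumberField K] {y : K}
    (h : ∀ P : IsDedekindDomain.HeightOneSpectrum (𝓞 K), HeightOneSpectrum.adicAbv K P y ≤ 1) :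
    IsIntegral ℤ y := by
  obtain ⟨z, rfl⟩ :=
    IsDedekindDomain.HeightOneSpectrum.mem_integers_of_valuation_le_one (R := 𝓞 K) K y fun P => by
      rw [← WithZeroMulInt.toNNReal_le_one_iff (HeightOneSpectrum.one_lt_absNorm_nnreal P)]
      exact_mod_cast h P
  exact z.2

/-- An algebraic integer that is small at all the places dividing `α` is divisible by a power
of `α`. -/
lemma isIntegral_div_alphaK_pow {y : FieldK S} (hy : IsIntegral ℤ y) (m : ℕ)
    (h : ∀ x : FinPlace S, ‖algebraMap (FieldK S) x.Kv y‖ ≤ ((x.q : ℝ) ^ (m * x.ν))⁻¹) :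
    IsIntegral ℤ (y / alphaK S ^ m) := by
  refine isIntegral_of_adicAbv_le_one fun P => ?_
  rw [map_div₀, map_pow]
  -- At primes dividing `α` the hypothesis on `y` absorbs the denominator; at all others `α` is a
  -- unit.
  by_cases hP : P.asIdeal ∣ Ideal.span {alphaO S}
  · have hα := norm_alphaK_finPlace (⟨P, hP⟩ : FinPlace S)
    have hy := h ⟨P, hP⟩
    have hq := FinPlace.one_lt_q (⟨P, hP⟩ : FinPlace S)
    rw [norm_algebraMap_finPlace] at hα hy
    rw [hα, inv_pow, ← pow_mul, mul_comm (FinPlace.ν _)]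
    exact div_le_one_of_le₀ hy (by positivity)
  · have hα : HeightOneSpectrum.adicAbv (FieldK S) P (alphaK S) = 1 := by
      rw [← FinitePlace.norm_embedding]
      refine (FinitePlace.norm_eq_one_iff_notMem (FieldK S) P (alphaO S)).2 fun hmem => hP ?_
      rwa [Ideal.dvd_span_singleton]
    rw [hα, one_pow, div_one, ← FinitePlace.norm_embedding]
    exact FinitePlace.norm_le_one (FieldK S) P (⟨y, hy⟩ : 𝓞 (FieldK S))

lemma one_le_prod_infinitePlace {K : Type*} [Field K] [NumberField K] {y : K}
    (hy : IsIntegral ℤ y) (h0 : y ≠ 0) : 1 ≤ ∏ x : InfinitePlace K, x y ^ x.mult := by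
  obtain ⟨a, rfl⟩ : ∃ a : 𝓞 K, (a : K) = y := ⟨⟨y, hy⟩, rfl⟩
  rw [InfinitePlace.prod_eq_abs_norm, ← Algebra.coe_norm_int, ← Int.cast_abs, Rat.cast_intCast,
    ← Int.cast_one, Int.cast_le]
  exact Int.one_le_abs (Algebra.norm_ne_zero_iff.mpr fun h => h0 (by simp [h]))

open scoped Classical in
lemma sum_mult_infPlace : ∑ x : InfPlace S, x.1.mult = n - 1 := by
  have h := InfinitePlace.sum_mult_eq (K := FieldK S)
  rw [finrank_fieldK, Fintype.sum_eq_add_sum_subtype_ne _ (expandingPlace S),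
    mult_expandingPlace] at h
  lia

/-- An algebraic integer cannot be small at all infinite places simultaneously. -/
lemma eq_zero_of_infinitePlace_le {y : FieldK S} (hy : IsIntegral ℤ y) {C : ℝ}
    (hreal : |(y : ℝ)| < C)
    (hinf : ∀ x : InfPlace S, x.1 y ≤ C⁻¹ ^ (1 / ((n : ℝ) - 1))) : y = 0 := by
  classical
  by_contra h0
  have hC : 0 < C := (abs_nonneg _).trans_lt hreal
  have hn : (1 : ℝ) < n := by exact_mod_cast S.two_le
  have h1 := one_le_prod_infinitePlace hy h0
  rw [Fintype.prod_eq_mul_prod_subtype_ne _ (expandingPlace S), mult_expandingPlace, pow_one,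
    expandingPlace_apply] at h1
  -- The exponent `1 / (n - 1)` is chosen for this: the multiplicities away from `v₁` sum to `n -
  -- 1`.
  have h2 : ∏ x : InfPlace S, x.1 y ^ x.1.mult ≤ C⁻¹ := by
    calc ∏ x : InfPlace S, x.1 y ^ x.1.mult
        ≤ ∏ x : InfPlace S, (C⁻¹ ^ (1 / ((n : ℝ) - 1))) ^ x.1.mult :=
          Finset.prod_le_prod (fun x _ => pow_nonneg (apply_nonneg _ _) _)
            fun x _ => pow_le_pow_left₀ (apply_nonneg _ _) (hinf x) _
      _ = C⁻¹ := by
          rw [Finset.prod_pow_eq_pow_sum, sum_mult_infPlace, ← Real.rpow_natCast,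
            ← Real.rpow_mul (by positivity), Nat.cast_sub (by have := S.two_le; lia), Nat.cast_one,
            one_div_mul_cancel (by linarith), Real.rpow_one]
  have h3 : |(y : ℝ)| * ∏ x : InfPlace S, x.1 y ^ x.1.mult ≤ |(y : ℝ)| * C⁻¹ :=
    mul_le_mul_of_nonneg_left h2 (abs_nonneg _)
  have h4 : |(y : ℝ)| * C⁻¹ < 1 := by rwa [← div_eq_mul_inv, div_lt_one hC]
  linarith

end Finite

end PisotSubst

namespace PisotSubst

variable {n : ℕ} {S : IrreduciblePisotSubstitution n}

/-! ### Degree of the polynomial part and its size at `v₁` -/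

section PolynomialPart

lemma aeval_coordPoly (y : FieldK S) : Polynomial.aeval (alphaK S) (coordPoly y) = y := by
  have h := (IntermediateField.adjoin.powerBasis (isIntegral_α S)).basis.sum_repr y
  rw [coordPoly, map_sum]
  refine Eq.trans (Finset.sum_congr rfl fun j _ => ?_) h
  rw [Polynomial.aeval_monomial, PowerBasis.basis_eq_pow, Algebra.smul_def,
    IntermediateField.adjoin.powerBasis_gen]
  rfl

lemma natDegree_coordPoly_le (y : FieldK S) : (coordPoly y).natDegree ≤ n - 1 := by
  refine Polynomial.natDegree_sum_le_of_forall_le _ _ fun j _ => ?_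
  have := j.2
  have h := powerBasis_dim S
  exact (Polynomial.natDegree_monomial_le _).trans (by lia)

lemma aeval_polyPartPoly (v : Fin n → FieldK S) (w : Fin n → ℚ) (ω₁ ω₂ : Subshift S) (d : ℕ) :
    Polynomial.aeval (alphaK S) (polyPartPoly v w ω₁ ω₂ d) = polyPart v w ω₁ ω₂ d := by
  simp [polyPartPoly, polyPart, aeval_coordPoly]

/-- The top term is `X^(d-1)` times a coordinate polynomial of degree at most `n - 1`. The condition
`1 ≤ d` is needed for `⟨w, v⟩`, whose degree may be `n - 1`. -/
lemma natDegree_polyPartPoly_le (v : Fin n → FieldK S) (w : Fin n → ℚ) (ω₁ ω₂ : Subshift S)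
    {d : ℕ} (hd : 1 ≤ d) : (polyPartPoly v w ω₁ ω₂ d).natDegree ≤ d + n - 2 := by
  have hn := S.two_le
  have hsum (ω : Subshift S) : (∑ k ∈ Finset.range d,
      Polynomial.X ^ k * coordPoly (digit v (ω.1 k))).natDegree ≤ d + n - 2 := by
    refine Polynomial.natDegree_sum_le_of_forall_le _ _ fun k hk => ?_
    have hk := Finset.mem_range.1 hk
    refine Polynomial.natDegree_mul_le.trans ?_
    have := natDegree_coordPoly_le (digit v (ω.1 k))
    rw [Polynomial.natDegree_X_pow]
    lia
  have hw : (coordPoly (pairing v w)).natDegree ≤ d + n - 2 :=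
    (natDegree_coordPoly_le _).trans (by lia)
  exact (Polynomial.natDegree_sub_le_of_le
    (Polynomial.natDegree_sub_le_of_le (hsum ω₁) (hsum ω₂)) hw).trans (by simp)

lemma abs_aeval_lt {p : Polynomial ℚ} {M a : ℝ} {N : ℕ} (hM : 0 < M) (ha : 1 < a)
    (hp : p.natDegree ≤ N) (hc : ∀ j, |((p.coeff j : ℚ) : ℝ)| ≤ M) :
    |Polynomial.aeval a p| < M / (1 - a⁻¹) * a ^ N := by
  have ha0 : 0 < a := by linarith
  have hrhs : M / (1 - a⁻¹) * a ^ N = M * (a ^ (N + 1) / (a - 1)) := by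
    have : a - 1 ≠ 0 := by linarith
    rw [show 1 - a⁻¹ = (a - 1) / a by field_simp, pow_succ]
    field_simp
  rw [Polynomial.aeval_eq_sum_range' (Nat.lt_succ_of_le hp), hrhs]
  calc |∑ i ∈ Finset.range (N + 1), p.coeff i • a ^ i|
      ≤ ∑ i ∈ Finset.range (N + 1), |p.coeff i • a ^ i| := Finset.abs_sum_le_sum_abs _ _
    _ ≤ ∑ i ∈ Finset.range (N + 1), M * a ^ i := by
        refine Finset.sum_le_sum fun i _ => ?_
        rw [Rat.smul_def, abs_mul, abs_of_nonneg (pow_nonneg ha0.le i)]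
        exact mul_le_mul_of_nonneg_right (hc i) (by positivity)
    _ = M * ((a ^ (N + 1) - 1) / (a - 1)) := by
        rw [← Finset.mul_sum, geom_sum_eq ha.ne']
    -- Strictness comes from dropping the `-1` of the geometric sum.
    _ < M * (a ^ (N + 1) / (a - 1)) := by
        have : 0 < a - 1 := by linarith
        gcongr
        linarith

lemma abs_polyPart_lt {v : Fin n → FieldK S} {w : Fin n → ℚ} {M : ℝ} (hM : IsCoeffBound v w M)
    (ω₁ ω₂ : Subshift S) {d : ℕ} (hd : 1 ≤ d) :
    |(polyPart v w ω₁ ω₂ d : ℝ)| < M / (1 - S.α⁻¹) * S.α ^ (d + n - 2) := by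
  have h := abs_aeval_lt hM.1 S.one_lt (natDegree_polyPartPoly_le v w ω₁ ω₂ hd) (hM.2 ω₁ ω₂ d)
  rw [← aeval_polyPartPoly]
  convert h using 2
  exact (Polynomial.aeval_algebraMap_apply ℝ (alphaK S) (polyPartPoly v w ω₁ ω₂ d)).symm.trans
    (congrArg (fun t : ℝ => Polynomial.aeval t (polyPartPoly v w ω₁ ω₂ d)) (coe_alphaK S))

end PolynomialPart

/-! ### Longest prefixes and a bound for the eigenvector -/

section Prefixes

lemma pairing_abel_append_singleton (v : Fin n → FieldK S) (p : List (Fin n)) (a : Fin n) :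
    pairing v (abel (p ++ [a])) = pairing v (abel p) + v a := by
  simp only [pairing, abel, List.count_append, List.count_singleton, Nat.cast_add, map_add, add_mul,
    Finset.sum_add_distrib]
  simp

lemma pairing_abel_image {v : Fin n → FieldK S} (hv : IsIntegralEigenvector S v) (b : Fin n) :
    pairing v (abel (S.σ b)) = alphaK S * v b := by
  have h := congrFun hv.eigen b
  rw [Pi.smul_apply, smul_eq_mul] at h
  rw [← h]
  simp [pairing, abel, Matrix.mulVec, dotProduct, incidence]

lemma isIntegral_digit {v : Fin n → FieldK S} (hv : IsIntegralEigenvector S v) (e : State S) :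
    IsIntegral ℤ (digit v e) := by
  rw [digit, pairing]
  refine IsIntegral.sum _ fun i _ => IsIntegral.mul ?_ (hv.integral i)
  have h : algebraMap ℚ (FieldK S) (abel e.pre i) = ((e.pre.count i : ℕ) : FieldK S) :=
    map_natCast _ _
  rw [h, ← map_natCast (algebraMap ℤ (FieldK S))]
  exact isIntegral_algebraMap

lemma digit_eq_zero_of_pre_eq_nil (v : Fin n → FieldK S) {e : State S} (he : e.pre = []) :
    digit v e = 0 := by
  simp [digit, he, pairing, abel]

lemma image_ne_nil {v : Fin n → FieldK S} (hv : IsIntegralEigenvector S v) (b : Fin n) :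
    S.σ b ≠ [] := by
  intro h
  have h1 := pairing_abel_image hv b
  have h2 : v b ≠ 0 := fun h0 => by simpa [h0] using hv.pos b
  have h3 := mul_ne_zero (alphaK_ne_zero S) h2
  rw [← h1, h] at h3
  simp [pairing, abel] at h3

/-- The state with the longest prefix determines the eigenvector coordinate of its letter. -/
lemma exists_state_digit_eq {v : Fin n → FieldK S} (hv : IsIntegralEigenvector S v) (b : Fin n) :
    ∃ e : State S, e.1 = b ∧ digit v e = alphaK S * v b - v e.letter := by
  have hlen := List.length_pos_of_ne_nil (image_ne_nil hv b)
  refine ⟨⟨b, ⟨(S.σ b).length - 1, by lia⟩⟩, rfl, ?_⟩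
  rw [← pairing_abel_image hv b, eq_sub_iff_add_eq, digit, ← pairing_abel_append_singleton]
  congr 2
  simp only [State.pre, State.letter, List.get_eq_getElem]
  rw [List.take_append_getElem, Nat.sub_add_cancel hlen, List.take_length]

lemma exists_state_letter_eq {N : ℕ} (hN : 0 < N)
    (hpos : ∀ i j, 0 < ((incidence S.σ) ^ N) i j) (c : Fin n) : ∃ e : State S, e.letter = c := by
  obtain ⟨b, hb⟩ : ∃ b, c ∈ S.σ b := by
    by_contra! h
    obtain ⟨N, rfl⟩ := Nat.exists_eq_succ_of_ne_zero hN.ne'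
    have h1 := hpos c c
    -- If `c` occurred in no image, row `c` of the incidence matrix, hence of all its positive
    -- powers, would vanish.
    rw [Nat.succ_eq_add_one, pow_succ', Matrix.mul_apply, Finset.sum_eq_zero] at h1
    · exact lt_irrefl _ h1
    · intro j _
      simp [incidence, List.count_eq_zero_of_not_mem (h j)]
  obtain ⟨i, hi⟩ := List.get_of_mem hb
  exact ⟨⟨b, i⟩, hi⟩

/-- Prepending a state to an element of the subshift. -/
def Subshift.cons (e : State S) (ω : Subshift S) (h : (ω.1 0).letter = e.1) : Subshift S :=
  ⟨fun k => k.casesOn e ω.1, fun k => by cases k with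
    | zero => exact h
    | succ k => exact ω.2 k⟩

/-- Every letter occurs in some image, so one can pass forever from a letter to one whose image
contains it. -/
lemma exists_subshift_letter_eq (hσ : ∀ c : Fin n, ∃ e : State S, e.letter = c) (b : Fin n) :
    ∃ ω : Subshift S, (ω.1 0).letter = b := by
  choose g hg using hσ
  exact ⟨⟨fun k => k.rec (g b) fun _ e => g e.1, fun k => hg _⟩, hg b⟩

/-- Prepending the state with the longest prefix multiplies the sum by `α` and adds `α v_a - v_c`,
where `a` is the old initial letter and `c` the new one; the terms in `v_a` cancel. -/
lemma exists_subshift_sum_eq {v : Fin n → FieldK S} (hv : IsIntegralEigenvector S v)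
    (hσ : ∀ c : Fin n, ∃ e : State S, e.letter = c) (b : Fin n) (d : ℕ) :
    ∃ ω : Subshift S, ∑ k ∈ Finset.range d, alphaK S ^ k * digit v (ω.1 k) =
      alphaK S ^ d * v b - v (ω.1 0).letter := by
  induction d with
  | zero =>
    obtain ⟨ω, h⟩ := exists_subshift_letter_eq hσ b
    exact ⟨ω, by simp [h]⟩
  | succ d ih =>
    obtain ⟨ω, h⟩ := ih
    obtain ⟨e, he, hdig⟩ := exists_state_digit_eq hv (ω.1 0).letter
    refine ⟨ω.cons e he.symm, ?_⟩
    have h0 : (ω.cons e he.symm).1 0 = e := rfl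
    have hs (k : ℕ) : (ω.cons e he.symm).1 (k + 1) = ω.1 k := rfl
    rw [Finset.sum_range_succ', h0, hdig]
    simp only [hs, pow_succ', mul_assoc, ← Finset.mul_sum, h]
    ring

/-- The coefficient bound controls the coordinates of the eigenvector. -/
lemma eigenvector_le {v : Fin n → FieldK S} (hv : IsIntegralEigenvector S v) {w : Fin n → ℚ}
    {M : ℝ} (hM : IsCoeffBound v w M) (hw : 0 ≤ (pairing v w : ℝ))
    (hσ : ∀ c : Fin n, ∃ e : State S, e.letter = c) {ω₀ : Subshift S}
    (hω₀ : ∀ k, (ω₀.1 k).pre = []) (b : Fin n) :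
    (v b : ℝ) ≤ M / (1 - S.α⁻¹) * S.α ^ (n - 2) := by
  have hα := S.one_lt
  have hα0 : 0 < S.α := by linarith
  set V : ℝ := ∑ i, (v i : ℝ)
  have hV (c : Fin n) : (v c : ℝ) ≤ V :=
    Finset.single_le_sum (f := fun i => (v i : ℝ)) (fun i _ => (hv.pos i).le) (Finset.mem_univ c)
  -- Comparing `ω₀`, all of whose digits vanish, with the longest-prefix sequences and dividing by
  -- `α^d` bounds `v_b - V α^(-d)`; then `d → ∞`.
  have hlim : Filter.Tendsto (fun d : ℕ => (v b : ℝ) - V * S.α⁻¹ ^ d) Filter.atTop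
      (nhds (v b)) := by
    have := (tendsto_pow_atTop_nhds_zero_of_lt_one (inv_nonneg.2 hα0.le)
      (inv_lt_one_of_one_lt₀ hα)).const_mul V |>.const_sub (v b : ℝ)
    simpa using this
  refine le_of_tendsto hlim ?_
  filter_upwards [Filter.eventually_ge_atTop 1] with d hd
  obtain ⟨ω, hω⟩ := exists_subshift_sum_eq hv hσ b d
  have hF : (polyPart v w ω₀ ω d : ℝ) =
      -(S.α ^ d * (v b : ℝ) - v (ω.1 0).letter) - pairing v w := by
    rw [polyPart, hω, Finset.sum_eq_zero fun k _ => by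
      rw [digit_eq_zero_of_pre_eq_nil v (hω₀ k), mul_zero]]
    push_cast
    rw [coe_alphaK]
    ring
  have h1 := abs_polyPart_lt hM ω₀ ω hd
  rw [hF, show d + n - 2 = (n - 2) + d by have := S.two_le; lia, pow_add, ← mul_assoc] at h1
  have h2 := (abs_lt.1 h1).1
  have h3 := hV (ω.1 0).letter
  have hd0 : 0 < S.α ^ d := by positivity
  rw [inv_pow, ← div_eq_mul_inv, ← mul_le_mul_iff_left₀ hd0, sub_mul, div_mul_cancel₀ _ hd0.ne']
  linarith

end Prefixes

end PisotSubst

namespace PisotSubst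

variable {n : ℕ} {S : IrreduciblePisotSubstitution n}

/-! ### Estimates of the polynomial part after a visit to the cylinder -/

section Cylinder

lemma shift_iterate_apply (ω : Subshift S) (d i : ℕ) : (shift^[d] ω).1 i = ω.1 (d + i) := by
  induction d generalizing ω with
  | zero => simp
  | succ d ih =>
    rw [Function.iterate_succ_apply, ih]
    exact congrArg ω.1 (by lia)

lemma digit_eq_zero_of_shift_mem (v : Fin n → FieldK S) {c : Fin n} {L d : ℕ} {ω : Subshift S}
    (h : shift^[d] ω ∈ specialCylinder S c L) {i : ℕ} (hi : i < L + 1) :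
    digit v (ω.1 (d + i)) = 0 := by
  have := (h i (by lia)).2
  rw [shift_iterate_apply] at this
  exact digit_eq_zero_of_pre_eq_nil v this

/-- If a cylinder of length at least two is nonempty, its state may be repeated forever. -/
lemma exists_subshift_pre_eq_nil {c : Fin n} {L : ℕ} (hL : 1 ≤ L) {ω : Subshift S}
    (h : ω ∈ specialCylinder S c L) : ∃ ω₀ : Subshift S, ∀ k, (ω₀.1 k).pre = [] := by
  refine ⟨⟨fun _ => ω.1 1, fun _ => ?_⟩, fun _ => (h 1 hL).2⟩
  exact (ω.2 0).trans ((h 0 (Nat.zero_le _)).1.trans (h 1 hL).1.symm)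

lemma algebraMap_polyPart {A : Type*} [CommRing A] [Algebra (FieldK S) A] (v : Fin n → FieldK S)
    (w : Fin n → ℚ) (ω₁ ω₂ : Subshift S) (d : ℕ) :
    algebraMap (FieldK S) A (polyPart v w ω₁ ω₂ d) =
      ∑ k ∈ Finset.range d,
        algebraMap (FieldK S) A (digit v (ω₁.1 k)) * algebraMap (FieldK S) A (alphaK S) ^ k -
      ∑ k ∈ Finset.range d,
        algebraMap (FieldK S) A (digit v (ω₂.1 k)) * algebraMap (FieldK S) A (alphaK S) ^ k -
      algebraMap (FieldK S) A (pairing v w) := by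
  simp [polyPart, mul_comm]

lemma isIntegral_polyPart {v : Fin n → FieldK S} (hv : IsIntegralEigenvector S v) {w : Fin n → ℚ}
    (hw : IsIntegral ℤ (pairing v w)) (ω₁ ω₂ : Subshift S) (d : ℕ) :
    IsIntegral ℤ (polyPart v w ω₁ ω₂ d) := by
  have h (ω : Subshift S) :
      IsIntegral ℤ (∑ k ∈ Finset.range d, alphaK S ^ k * digit v (ω.1 k)) :=
    IsIntegral.sum _ fun k _ => ((isIntegral_alphaK S).pow k).mul (isIntegral_digit hv _)
  exact ((h ω₁).sub (h ω₂)).sub hw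

lemma norm_digit_le_digitMax (v : Fin n → FieldK S) (x : InfPlace S) (e : State S) :
    ‖algebraMap (FieldK S) x.Kv (digit v e)‖ ≤ digitMax v x :=
  le_ciSup (f := fun e : State S => ‖algebraMap (FieldK S) x.Kv (digit v e)‖)
    (Set.finite_range _).bddAbove e

variable {v : Fin n → FieldK S} {w : Fin n → ℚ} {M : ℝ} {L d : ℕ} {c : Fin n} {ω₁ ω₂ : Subshift S}

lemma infinitePlace_polyPart_lt (hM : 0 < M) (hL : IsCylinderLength v M L)
    (h₁ : shift^[d] ω₁ ∈ specialCylinder S c L) (h₂ : shift^[d] ω₂ ∈ specialCylinder S c L)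
    (hmem : Psi v ω₂ + diag S (pairing v w) ∈ nbhd M (d + 1) (Psi v ω₁)) (x : InfPlace S) :
    x.1 (polyPart v w ω₁ ω₂ d) <
      absAlpha x ^ (d + n - 2) * (M / (1 - S.α⁻¹))⁻¹ ^ (1 / ((n : ℝ) - 1)) := by
  have hn := S.two_le
  have hα := S.one_lt
  have ha0 := absAlpha_pos S x
  have ha1 := absAlpha_lt_one S x
  have hC : 0 < M / (1 - S.α⁻¹) := div_pos hM (sub_pos.2 (inv_lt_one_of_one_lt₀ hα))
  have tail {ω : Subshift S} (h : shift^[d] ω ∈ specialCylinder S c L) :=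
    norm_tsum_sub_sum_le (m := L + 1) ha1 (fun k => norm_digit_le_digitMax v x (ω.1 k))
      fun i hi => by rw [digit_eq_zero_of_shift_mem v h hi, map_zero]
  have t₁ := tail h₁
  have t₂ := tail h₂
  have hX := hmem.1 x
  have hlen := hL.infinite x
  rw [← norm_algebraMap_infPlace, algebraMap_polyPart]
  simp only [Psi, diag, Prod.fst_add, Pi.add_apply] at hX
  rw [← inv_div M, show d + 1 + n - 2 = (d + n - 2) + 1 by lia, pow_succ] at hX
  change _ ≤ absAlpha x ^ (d + (L + 1)) * (_ / (1 - absAlpha x)) at t₁ t₂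
  set C := M / (1 - S.α⁻¹)
  set e := 1 / ((n : ℝ) - 1)
  set B := digitMax v x / (1 - absAlpha x)
  have hr : 0 < C⁻¹ ^ e := by positivity
  have hrC : C ^ e * C⁻¹ ^ e = 1 := by
    rw [← Real.mul_rpow hC.le (by positivity), mul_inv_cancel₀ hC.ne', Real.one_rpow]
  -- This splitting explains the exponent `L - n + 3` in the length condition; it is an integer
  -- power because its sign is not known here.
  have hexp : absAlpha x ^ (d + (L + 1)) =
      absAlpha x ^ (d + n - 2) * absAlpha x ^ ((L : ℤ) - n + 3) := by
    rw [← zpow_natCast, ← zpow_natCast, ← zpow_add₀ ha0.ne']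
    congr 1
    lia
  -- The length condition is scaled by the target bound `|α_v|^(d+n-2) * C^(-1/(n-1))`: its two
  -- summands become the two tails together and the radius of `O_{d+1}`.
  have hkey := mul_lt_mul_of_pos_left hlen (mul_pos (pow_pos ha0 (d + n - 2)) hr)
  have hkey' : absAlpha x ^ (d + n - 2) * absAlpha x * C⁻¹ ^ e +
      2 * (absAlpha x ^ (d + (L + 1)) * B) < absAlpha x ^ (d + n - 2) * C⁻¹ ^ e := by
    rw [hexp]
    calc _ = absAlpha x ^ (d + n - 2) * absAlpha x * C⁻¹ ^ e +
          2 * (absAlpha x ^ (d + n - 2) * absAlpha x ^ ((L : ℤ) - n + 3) * B) *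
            (C ^ e * C⁻¹ ^ e) := by rw [hrC, mul_one]
      _ = _ := by ring
      _ < _ := hkey
      _ = _ := mul_one _
  refine lt_of_le_of_lt ?_ hkey'
  generalize ∑ k ∈ Finset.range d, algebraMap (FieldK S) x.Kv (digit v (ω₁.1 k)) *
    algebraMap (FieldK S) x.Kv (alphaK S) ^ k = s₁ at *
  generalize ∑ k ∈ Finset.range d, algebraMap (FieldK S) x.Kv (digit v (ω₂.1 k)) *
    algebraMap (FieldK S) x.Kv (alphaK S) ^ k = s₂ at *
  generalize (∑' k, algebraMap (FieldK S) x.Kv (digit v (ω₁.1 k)) *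
    algebraMap (FieldK S) x.Kv (alphaK S) ^ k) = X₁ at *
  generalize (∑' k, algebraMap (FieldK S) x.Kv (digit v (ω₂.1 k)) *
    algebraMap (FieldK S) x.Kv (alphaK S) ^ k) = X₂ at *
  generalize algebraMap (FieldK S) x.Kv (pairing v w) = y at *
  have hsplit : s₁ - s₂ - y = (X₁ - (X₂ + y)) - (X₁ - s₁) + (X₂ - s₂) := by ring
  rw [hsplit]
  have := norm_add_le ((X₁ - (X₂ + y)) - (X₁ - s₁)) (X₂ - s₂)
  have := norm_sub_le (X₁ - (X₂ + y)) (X₁ - s₁)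
  linarith

lemma norm_finPlace_polyPart_le (hv : IsIntegralEigenvector S v) (hL : IsCylinderLength v M L)
    (h₁ : shift^[d] ω₁ ∈ specialCylinder S c L) (h₂ : shift^[d] ω₂ ∈ specialCylinder S c L)
    (hmem : Psi v ω₂ + diag S (pairing v w) ∈ nbhd M (d + 1) (Psi v ω₁)) (x : FinPlace S) :
    ‖algebraMap (FieldK S) x.Kv (polyPart v w ω₁ ω₂ d)‖ ≤
      ((x.q : ℝ) ^ ((d + n - 2) * x.ν))⁻¹ := by
  have hn := S.two_le
  have hq : (1 : ℝ) < x.q := by exact_mod_cast x.one_lt_q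
  have hq0 : (0 : ℝ) < x.q := by linarith
  have hlen := hL.finite x
  -- If `ν = 0`, the second summand of the length condition would already be `1`.
  have hν : x.ν ≠ 0 := by
    intro h
    have : (0 : ℝ) < (1 / (x.q : ℝ)) ^ ((x.ν : ℤ) * ((L : ℤ) - n + 3)) := by positivity
    rw [h, pow_zero] at hlen
    rw [h] at this
    linarith
  -- Otherwise `L - n + 3 ≤ 0`, and the first summand of the length condition would be at least `2`.
  have hLn : n ≤ L + 2 := by
    by_contra! hlt
    have h1 : (1 : ℝ) ≤ (1 / (x.q : ℝ)) ^ ((x.ν : ℤ) * ((L : ℤ) - n + 3)) := by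
      rw [one_div, inv_zpow', ← mul_neg]
      exact one_le_zpow₀ hq.le (mul_nonneg (by lia) (by lia))
    have h2 : (0 : ℝ) < (1 / (x.q : ℝ)) ^ x.ν := by positivity
    linarith
  have hα1 : ‖algebraMap (FieldK S) x.Kv (alphaK S)‖ < 1 := by
    rw [norm_alphaK_finPlace]
    exact inv_lt_one_of_one_lt₀ (one_lt_pow₀ hq hν)
  have hmono {k : ℕ} (hk : d + n - 2 ≤ k) :
      ((x.q : ℝ) ^ (k * x.ν))⁻¹ ≤ ((x.q : ℝ) ^ ((d + n - 2) * x.ν))⁻¹ := by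
    gcongr
    exact hq.le
  have tail {ω : Subshift S} (h : shift^[d] ω ∈ specialCylinder S c L) :=
    norm_tsum_sub_sum_le_of_ultrametric (m := L + 1) hα1
      (fun k => norm_finPlace_le_one x (isIntegral_digit hv (ω.1 k)))
      fun i hi => by rw [digit_eq_zero_of_shift_mem v h hi, map_zero]
  have t₁ := tail h₁
  have t₂ := tail h₂
  rw [norm_alphaK_finPlace, inv_pow, ← pow_mul, mul_comm x.ν] at t₁ t₂
  replace t₁ := t₁.trans (hmono (by lia))
  replace t₂ := t₂.trans (hmono (by lia))
  have hX := (hmem.2 x).le.trans (hmono (by lia))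
  rw [algebraMap_polyPart]
  simp only [Psi, diag, Prod.snd_add, Pi.add_apply] at hX
  generalize ∑ k ∈ Finset.range d, algebraMap (FieldK S) x.Kv (digit v (ω₁.1 k)) *
    algebraMap (FieldK S) x.Kv (alphaK S) ^ k = s₁ at *
  generalize ∑ k ∈ Finset.range d, algebraMap (FieldK S) x.Kv (digit v (ω₂.1 k)) *
    algebraMap (FieldK S) x.Kv (alphaK S) ^ k = s₂ at *
  generalize (∑' k, algebraMap (FieldK S) x.Kv (digit v (ω₁.1 k)) *
    algebraMap (FieldK S) x.Kv (alphaK S) ^ k) = X₁ at *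
  generalize (∑' k, algebraMap (FieldK S) x.Kv (digit v (ω₂.1 k)) *
    algebraMap (FieldK S) x.Kv (alphaK S) ^ k) = X₂ at *
  generalize algebraMap (FieldK S) x.Kv (pairing v w) = y at *
  rw [norm_sub_rev] at t₁
  -- By the ultrametric inequality it suffices that each of the three terms satisfies the bound.
  have hsplit : s₁ - s₂ - y = (X₁ - (X₂ + y)) + (s₁ - X₁) + (X₂ - s₂) := by ring
  rw [hsplit]
  exact (IsUltrametricDist.norm_add_le_max _ _).trans
    (max_le ((IsUltrametricDist.norm_add_le_max _ _).trans (max_le hX t₁)) t₂)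

/-- For `d = 0` the polynomial part is `-⟨w, v⟩`, and `0 ≤ ⟨w, v⟩ < v_b`. The visit to the cylinder
supplies the sequence with empty prefixes that `eigenvector_le` needs. -/
lemma abs_polyPart_lt_of_mem_cylinder (hv : IsIntegralEigenvector S v) {b : Fin n}
    (hw : (w, b) ∈ translationVectors v) (hM : IsCoeffBound v w M) (hL : IsCylinderLength v M L)
    (h₁ : shift^[d] ω₁ ∈ specialCylinder S c L) :
    |(polyPart v w ω₁ ω₂ d : ℝ)| < M / (1 - S.α⁻¹) * S.α ^ (d + n - 2) := by
  rcases Nat.eq_zero_or_pos d with rfl | hd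
  · obtain ⟨N, hN, hpos, hNL⟩ := hL.primitive
    obtain ⟨ω₀, hω₀⟩ := exists_subshift_pre_eq_nil (by lia) h₁
    have hle := eigenvector_le hv hM hw.2.1 (exists_state_letter_eq hN hpos) hω₀ b
    have hlt : (pairing v (w - Pi.single b 1) : ℝ) < 0 := hw.2.2
    have hsub : pairing v (w - Pi.single b 1) = pairing v w - v b := by
      simp only [pairing, Pi.sub_apply, map_sub, sub_mul, Finset.sum_sub_distrib]
      congr 1
      rw [Finset.sum_eq_single_of_mem b (Finset.mem_univ b) fun i _ hi => by simp [hi]]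
      simp
    rw [hsub] at hlt
    push_cast at hlt
    have hF : polyPart v w ω₁ ω₂ 0 = -pairing v w := by simp [polyPart]
    rw [hF, zero_add]
    push_cast
    rw [abs_neg, abs_of_nonneg hw.2.1]
    linarith
  · exact abs_polyPart_lt hM ω₁ ω₂ hd

end Cylinder

end PisotSubst

/-! ### The dichotomy -/

theorem mainTheorem6 {n : ℕ} (S : IrreduciblePisotSubstitution n)
    (u : ℤ → Fin n) (hu : IsFixedPoint S u)
    (v : Fin n → FieldK S) (hv : IsIntegralEigenvector S v)
    (w : Fin n → ℚ) (b : Fin n) (hw : (w, b) ∈ translationVectors v)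
    (hwint : IsIntegral ℤ (pairing v w))
    (M : ℝ) (hM : IsCoeffBound v w M)
    (L : ℕ) (hL : IsCylinderLength v M L)
    (d : ℕ) (ω₁ ω₂ : Subshift S)
    (hvisit : (Prod.map shift shift)^[d] (ω₁, ω₂) ∈
      specialCylinder S (u 0) L ×ˢ specialCylinder S (u 0) L) :
    polyPart v w ω₁ ω₂ d = 0 ∨
      Psi v ω₂ + diag S (pairing v w) ∉ nbhd M (d + 1) (Psi v ω₁) := by
  rw [or_iff_not_imp_right, not_not]
  intro hmem
  rw [Prod.map_iterate] at hvisit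
  obtain ⟨h₁, h₂⟩ := hvisit
  have hα0 : 0 < S.α := by linarith [S.one_lt]
  -- Dividing by `α^(d+n-2)` removes the dependence on `d` from all the infinite-place bounds.
  have hG := isIntegral_div_alphaK_pow (isIntegral_polyPart hv hwint ω₁ ω₂ d) (d + n - 2)
    (norm_finPlace_polyPart_le hv hL h₁ h₂ hmem)
  have hzero := eq_zero_of_infinitePlace_le hG (C := M / (1 - S.α⁻¹)) ?_ fun x => ?_
  · exact (div_eq_zero_iff.1 hzero).resolve_right (pow_ne_zero _ (alphaK_ne_zero S))
  · push_cast
    rw [coe_alphaK, abs_div, abs_of_pos (pow_pos hα0 _), div_lt_iff₀ (pow_pos hα0 _)]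
    exact abs_polyPart_lt_of_mem_cylinder hv hw hM hL h₁
  · rw [map_div₀, map_pow, ← absAlpha_eq, div_le_iff₀' (pow_pos (absAlpha_pos S x) _)]
    exact (infinitePlace_polyPart_lt hM.1 hL h₁ h₂ hmem x).le
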